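/- Let $\mathcal G$ be a strongly connected directed graph with finite vertex set $\{1,\dots,N\}$ and adjacency matrix $A$ ($a_{ij}=1$ if there is an edge from $j$ to $i$, and $0$ otherwise; self-loops are allowed). Let $d_i^{\mathrm{in}}=\sum_j a_{ij}$ and $d_j^{\mathrm{out}}=\sum_i a_{ij}$ be the in- and out-degrees, let $D_{\mathrm{in}}$ and $D_{\mathrm{out}}$ be the corresponding diagonal matrices, and let $L=D_{\mathrm{in}}^{-1/2}AD_{\mathrm{out}}^{-1/2}\in\mathbb R^{N\times N}$ be the symmetrically normalized adjacency (an isolated single vertex has $L=0$). For a complex matrix $M\in\mathbb C^{n\times n}$ let $\lambda_1(M),\dots,\lambda_n(M)$ be its eigenvalues ordered by increasing real part. For $x\in\mathbb C^{N\times K}$ with rows $x_i$ define the Dirichlet energy $$\mathfrak E(x)=\frac14\sum_{i,j=1}^N a_{ij}\Big\|\frac{x_i}{\sqrt{d_i^{\mathrm{in}}}}-\frac{x_j}{\sqrt{d_j^{\mathrm{out}}}}\Big\|_2^2 .$$ A sequence $(x_n)_{n\ge 0}$ in $\mathbb C^{N\times K}$ is called $\lambda$-frequency-dominant, for a real $\lambda\ge0$,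 if $\mathfrak E(x_n/\|x_n\|_2)\to\lambda/2$ as $n\to\infty$, where $\|\cdot\|_2$ is the Frobenius norm. It is called highest-frequency-dominant (HFD), respectively lowest-frequency-dominant (LFD), if it is $\lambda$-frequency-dominant with $\lambda$ a real eigenvalue of $I-L$ whose real part is the largest, respectively the smallest, among all eigenvalues of $I-L$. Let $W\in\mathbb R^{K\times K}$ be diagonal with smallest eigenvalue $\lambda_1(W)$ and largest eigenvalue $\lambda_K(W)$. Consider the heat equation $x'(t)=-L\,x(t)\,W$, $x(0)=x_0$, and its explicit Euler approximation with step size $h$, that is, $x_{n+1}=x_n-h\,L\,x_n\,W$. Then there is $h_0>0$ (depending only on $\mathcal G$ and $W$) such that for every $h\in(0,h_0)$ the following holds for (Lebesgue-)almost every $x_0\in\mathbb C^{N\times K}$. 1. If $\lambda_1(L)$ is the unique eigenvalue of $L$ with smallest real part and $\lambda_K(W)\,\Re\lambda_1(L)<\lambda_1(W)\,\Re\lambda_N(L)$, then $(x_n)_{n\ge0}$ is HFD. 2. If $\lambda_K(W)\,\Re\lambda_1(L)>\lambda_1(W)\,\Re\lambda_N(L)$, and, in case $\mathcal G$ has self-loops,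 also $\lambda_1(W)<0$ (which is automatic if $\mathcal G$ has no self-loops), then $(x_n)_{n\ge0}$ is LFD. -/

import Mathlib

open Filter Topology MeasureTheory

noncomputable section

namespace GraphHeat

variable {V : Type*} [Fintype V] [DecidableEq V]

/-- Every vertex can be reached from every vertex by a directed path. -/
def StronglyConnected (G : Digraph V) : Prop :=
  ∀ u v : V, Relation.ReflTransGen G.Adj u v

open Classical in
/-- Adjacency matrix: the entry `(i, j)` is `1` if there is an edge from `j` to `i`. -/
def adjacency (G : Digraph V) : Matrix V V ℝ :=
  Matrix.of fun i j => if G.Adj j i then 1 else 0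

/-- The in-degree of `i`, the `i`-th row sum of the adjacency matrix. -/
def inDegree (G : Digraph V) (i : V) : ℝ := ∑ j, adjacency G i j

/-- The out-degree of `j`, the `j`-th column sum of the adjacency matrix. -/
def outDegree (G : Digraph V) (j : V) : ℝ := ∑ i, adjacency G i j

/-- The symmetrically normalized adjacency `D_in^(-1/2) A D_out^(-1/2)`. -/
def sna (G : Digraph V) : Matrix V V ℝ :=
  Matrix.diagonal (fun i => (Real.sqrt (inDegree G i))⁻¹) * adjacency G *
    Matrix.diagonal (fun j => (Real.sqrt (outDegree G j))⁻¹)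

/-- The symmetrically normalized adjacency, as a complex matrix. -/
def snaC (G : Digraph V) : Matrix V V ℂ := (sna G).map Complex.ofReal

/-- `l` is an eigenvalue of `M` whose real part is the smallest (a choice of `λ₁(M)`). -/
def IsLowestEigenvalue (M : Matrix V V ℂ) (l : ℂ) : Prop :=
  l ∈ spectrum ℂ M ∧ ∀ m ∈ spectrum ℂ M, l.re ≤ m.re

/-- `l` is an eigenvalue of `M` whose real part is the largest (a choice of `λ_N(M)`). -/
def IsHighestEigenvalue (M : Matrix V V ℂ) (l : ℂ) : Prop :=
  l ∈ spectrum ℂ M ∧ ∀ m ∈ spectrum ℂ M, m.re ≤ l.re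

variable {K : ℕ}

/-- The Dirichlet energy
`(1/4) ∑ a_{ij} ‖x_i / √(d_i^in) - x_j / √(d_j^out)‖²` of node features with `K` channels. -/
def dirichletEnergy (G : Digraph V) (x : Matrix V (Fin K) ℂ) : ℝ :=
  (1 / 4) * ∑ i, ∑ j, adjacency G i j *
    ∑ k, ‖x i k / (Real.sqrt (inDegree G i) : ℂ) - x j k / (Real.sqrt (outDegree G j) : ℂ)‖ ^ 2

/-- The Frobenius norm of a feature matrix. -/
def frobenius (x : Matrix V (Fin K) ℂ) : ℝ := Real.sqrt (∑ i, ∑ k, ‖x i k‖ ^ 2)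

/-- The feature matrix divided by its Frobenius norm. -/
def normalized (x : Matrix V (Fin K) ℂ) : Matrix V (Fin K) ℂ := (frobenius x)⁻¹ • x

/-- A discrete-time trajectory is `l`-frequency-dominant. -/
def IsFrequencyDominant (G : Digraph V) (x : ℕ → Matrix V (Fin K) ℂ) (l : ℝ) : Prop :=
  0 ≤ l ∧ Tendsto (fun n => dirichletEnergy G (normalized (x n))) atTop (𝓝 (l / 2))

/-- Lowest-frequency-dominant: `l`-frequency-dominant, where the real number `l` is the
eigenvalue of `I - L` with smallest real part. -/
def IsLFD (G : Digraph V) (x : ℕ → Matrix V (Fin K) ℂ) : Prop :=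
  ∃ l : ℝ, IsLowestEigenvalue (1 - snaC G) (l : ℂ) ∧ IsFrequencyDominant G x l

/-- Highest-frequency-dominant: `l`-frequency-dominant, where the real number `l` is the
eigenvalue of `I - L` with largest real part. -/
def IsHFD (G : Digraph V) (x : ℕ → Matrix V (Fin K) ℂ) : Prop :=
  ∃ l : ℝ, IsHighestEigenvalue (1 - snaC G) (l : ℂ) ∧ IsFrequencyDominant G x l

/-- The right-hand side of the graph heat equation `x' = - L x W`. -/
def heatField (G : Digraph V) (W : Matrix (Fin K) (Fin K) ℝ)
    (x : Matrix V (Fin K) ℂ) : Matrix V (Fin K) ℂ :=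
  -(snaC G * x * W.map Complex.ofReal)

/-- The explicit Euler scheme with step size `h` for the autonomous equation `x' = f x`:
`eulerScheme f h x₀ n` approximates the solution at time `n h`. -/
def eulerScheme (f : Matrix V (Fin K) ℂ → Matrix V (Fin K) ℂ) (h : ℝ)
    (x₀ : Matrix V (Fin K) ℂ) : ℕ → Matrix V (Fin K) ℂ
  | 0 => x₀
  | n + 1 => eulerScheme f h x₀ n + h • f (eulerScheme f h x₀ n)

end GraphHeat

end

/-!
The Euler iteration of `x' = -B x`, where `B x = L x W`, is a power iteration: for small `h` the
eigenvalue `1 - h c` of `1 - h B` of largest modulus comes from the eigenvalue `c` of `B` with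
smallest real part. Splitting `x₀` into generalized eigenvectors, and letting the highest
nilpotent power on the dominant block win, shows that off a proper subspace, which is a null set,
the iterates converge in direction to some `u` with `B u = c u`.

The eigenvalues of `B` are the products `w μ` of an eigenvalue `w` of `W` and an eigenvalue `μ` of
`L`. If `μ = l` is the only `μ` for which some `w μ` has real part `c`, and then `w ≠ 0`, testing
`L u W = c u` on eigenvectors of `W` gives `L u = l u`. Since
`dirichletEnergy G x = (‖x‖ ^ 2 - Re tr (xᴴ L x)) / 2`, the energy of the normalized iterates then
tends to `(1 - l) / 2`.

It remains to find which `l` minimizes `Re (w μ)`. By Perron–Frobenius the highest eigenvalue of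
`L` is real and bounds the modulus of all others, and the sign of `w` decides between the two ends
of the spectrum. Without self-loops `tr L = 0`, so that the lowest real part is not positive.
-/

noncomputable section

namespace GraphHeat

open Finset (range)
open Asymptotics

section GeneralizedEigenspaces

variable {R M : Type*} [CommRing R] [AddCommGroup M] [Module R M] {T : Module.End R M} {μ : R}

theorem exists_sub_smul_pow_apply_ne_zero {x : M} (hx : x ∈ T.maxGenEigenspace μ) (hx₀ : x ≠ 0) :
    ∃ m : ℕ, ((T - μ • (1 : Module.End R M)) ^ m) x ≠ 0 ∧
      ((T - μ • (1 : Module.End R M)) ^ (m + 1)) x = 0 := by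
  obtain ⟨k, hk⟩ := (Module.End.mem_maxGenEigenspace T μ x).1 hx
  by_contra! hstep
  have hne : ∀ m, ((T - μ • (1 : Module.End R M)) ^ m) x ≠ 0 := fun m =>
    Nat.recOn m (by rwa [pow_zero]) hstep
  exact hne k hk

theorem pow_apply_eq_sum_of_sub_smul_pow_apply_eq_zero {k : ℕ} {x : M}
    (hx : ((T - μ • (1 : Module.End R M)) ^ k) x = 0) (n : ℕ) :
    (T ^ n) x = ∑ j ∈ range k,
      (n.choose j * μ ^ (n - j)) • ((T - μ • (1 : Module.End R M)) ^ j) x := by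
  let N : Module.End R M := T - μ • (1 : Module.End R M)
  have hcomm : Commute N (μ • (1 : Module.End R M)) := (Commute.one_right N).smul_right μ
  have hbinomial : (T ^ n) x = ∑ j ∈ range (n + 1), (n.choose j * μ ^ (n - j)) • (N ^ j) x := by
    rw [← sub_add_cancel T (μ • (1 : Module.End R M)), hcomm.add_pow, LinearMap.sum_apply]
    refine Finset.sum_congr rfl fun j _ => ?_
    rw [smul_pow, one_pow, ← nsmul_one (n.choose j)]
    simp only [Module.End.mul_apply, LinearMap.smul_apply, Module.End.one_apply, map_smul,
      ← Nat.cast_smul_eq_nsmul R, smul_smul]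
  have hchoose : ∀ j ≥ n + 1, (n.choose j * μ ^ (n - j)) • (N ^ j) x = 0 := fun j hj => by
    rw [Nat.choose_eq_zero_of_lt hj, Nat.cast_zero, zero_mul, zero_smul]
  have hkill : ∀ j ≥ k, (n.choose j * μ ^ (n - j)) • (N ^ j) x = 0 := fun j hj => by
    rw [← Nat.sub_add_cancel hj, pow_add, Module.End.mul_apply, hx, map_zero, smul_zero]
  rw [hbinomial, ← Finset.eventually_constant_sum hchoose (le_max_left (n + 1) k),
    Finset.eventually_constant_sum hkill (le_max_right (n + 1) k)]

theorem eigenspace_one_sub_smul {K N : Type*} [Field K] [AddCommGroup N] [Module K N]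
    (B : Module.End K N) {h : K} (hh : h ≠ 0) (κ : K) :
    (1 - h • B).eigenspace (1 - h * κ) = B.eigenspace κ := by
  ext x
  rw [Module.End.mem_eigenspace_iff, Module.End.mem_eigenspace_iff, ← smul_right_inj hh (m₁ := B x),
    ← sub_right_inj (a := x) (b := h • B x), sub_smul, one_smul, mul_smul]
  rfl

theorem eventually_norm_one_sub_mul_lt {a : ℂ} {c : ℝ} (h : c < a.re) :
    ∀ᶠ t : ℝ in 𝓝[>] 0, ‖1 - (t : ℂ) * a‖ < 1 - t * c := by
  have hpos : ∀ᶠ t : ℝ in 𝓝 0, 0 < 1 - t * c :=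
    (by fun_prop : Continuous fun t : ℝ => 1 - t * c).tendsto 0 |>.eventually_const_lt (by simp)
  have hfirst : ∀ᶠ t : ℝ in 𝓝 0, t * (‖a‖ ^ 2 - c ^ 2) < 2 * (a.re - c) :=
    (by fun_prop : Continuous fun t : ℝ => t * (‖a‖ ^ 2 - c ^ 2)).tendsto 0
      |>.eventually_lt_const (by simpa using h)
  filter_upwards [nhdsWithin_le_nhds hpos, nhdsWithin_le_nhds hfirst, self_mem_nhdsWithin]
    with t ht ht' (ht₀ : 0 < t)
  have hsq : ‖1 - (t : ℂ) * a‖ ^ 2 = 1 - 2 * t * a.re + t ^ 2 * ‖a‖ ^ 2 := by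
    simp only [Complex.sq_norm, Complex.normSq_apply, Complex.sub_re, Complex.one_re,
      Complex.re_ofReal_mul, Complex.sub_im, Complex.one_im, Complex.im_ofReal_mul]
    ring
  refine lt_of_pow_lt_pow_left₀ 2 ht.le ?_
  rw [hsq]
  linear_combination t * ht'

theorem eventually_norm_lt_of_hasEigenvalue_one_sub_smul {E : Type*} [AddCommGroup E] [Module ℂ E]
    [FiniteDimensional ℂ E] {B : Module.End ℂ E} {c : ℝ}
    (hc : ∀ κ, B.HasEigenvalue κ → κ ≠ c → c < κ.re) :
    ∀ᶠ h : ℝ in 𝓝[>] 0, ∀ μ, (1 - (h : ℂ) • B).HasEigenvalue μ →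
      μ ≠ ((1 - h * c : ℝ) : ℂ) → ‖μ‖ < 1 - h * c := by
  have hev : ∀ᶠ h : ℝ in 𝓝[>] 0, ∀ κ ∈ {κ | B.HasEigenvalue κ}, κ ≠ c →
      ‖1 - (h : ℂ) * κ‖ < 1 - h * c :=
    (eventually_all_finite B.finite_hasEigenvalue).2 fun κ hκ => by
      by_cases hκc : κ = c
      · exact Eventually.of_forall fun _ hne => absurd hκc hne
      · filter_upwards [eventually_norm_one_sub_mul_lt (hc κ hκ hκc)] with h hh _ using hh
  filter_upwards [hev, self_mem_nhdsWithin] with h hh (hpos : 0 < h) μ hμ hne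
  have hh₀ : (h : ℂ) ≠ 0 := Complex.ofReal_ne_zero.2 hpos.ne'
  obtain ⟨κ, rfl⟩ : ∃ κ, μ = 1 - (h : ℂ) * κ :=
    ⟨(1 - μ) / h, by rw [mul_div_cancel₀ _ hh₀, sub_sub_cancel]⟩
  rw [Module.End.hasEigenvalue_iff, eigenspace_one_sub_smul B hh₀, ← Module.End.hasEigenvalue_iff]
    at hμ
  refine hh κ hμ fun hκ => hne ?_
  rw [hκ]
  push_cast
  rfl

end GeneralizedEigenspaces

section PowerIteration

theorem tendsto_inv_pow_mul_choose_mul_pow {𝕜 : Type*} [NormedField 𝕜] [CompleteSpace 𝕜] {μ ν : 𝕜}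
    (h : ‖μ‖ < ‖ν‖) (j : ℕ) :
    Tendsto (fun n : ℕ => ν⁻¹ ^ n * (n.choose j * μ ^ (n - j))) atTop (𝓝 0) := by
  have hratio : ‖ν⁻¹ * μ‖ < 1 := by
    rw [norm_mul, norm_inv, inv_mul_lt_one₀ ((norm_nonneg μ).trans_lt h)]
    exact h
  have hlim := (summable_choose_mul_geometric_of_norm_lt_one j hratio).tendsto_atTop_zero.const_mul
    (ν⁻¹ ^ j)
  rw [← tendsto_add_atTop_iff_nat j, ← mul_zero (ν⁻¹ ^ j)]
  refine hlim.congr fun n => ?_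
  rw [Nat.add_sub_cancel, mul_pow, pow_add]
  ring

theorem tendsto_choose_div_choose {j m : ℕ} (hjm : j ≤ m) :
    Tendsto (fun n : ℕ => (n.choose j : ℝ) / n.choose m) atTop (𝓝 (if j = m then 1 else 0)) := by
  split_ifs with h
  · subst h
    refine tendsto_const_nhds.congr' ?_
    filter_upwards [eventually_ge_atTop j] with n hn
    rw [div_self (Nat.cast_ne_zero.2 (Nat.choose_pos hn).ne')]
  · have hpow : (fun n : ℕ => (n : ℝ) ^ j) =o[atTop] fun n : ℕ => (n : ℝ) ^ m :=
      (isLittleO_pow_pow_atTop_of_lt (lt_of_le_of_ne hjm h)).comp_tendsto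
        tendsto_natCast_atTop_atTop
    exact (((isTheta_choose j).trans_isLittleO hpow).trans_isTheta
      (isTheta_choose m).symm).tendsto_div_nhds_zero

variable {E : Type*} [AddCommGroup E] [Module ℂ E] [TopologicalSpace E]

/-- The sequence `x` converges to the nonzero vector `u` up to positive real rescaling. -/
def TendstoInDirection (x : ℕ → E) (u : E) : Prop :=
  u ≠ 0 ∧ ∃ c : ℕ → ℝ, (∀ᶠ n in atTop, 0 < c n) ∧ Tendsto (fun n => (c n : ℂ) • x n) atTop (𝓝 u)

variable [ContinuousAdd E] [ContinuousSMul ℂ E] {T : Module.End ℂ E} {ν : ℂ}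

/-- The vectors whose orbit under `T` is of smaller order than `ν ^ n`; a power iteration with
dominant eigenvalue `ν` does not see them. -/
def decaySubmodule (T : Module.End ℂ E) (ν : ℂ) : Submodule ℂ E where
  carrier := {x | Tendsto (fun n : ℕ => ν⁻¹ ^ n • (T ^ n) x) atTop (𝓝 0)}
  zero_mem' := by simpa only [Set.mem_ofPred_eq, map_zero, smul_zero] using tendsto_const_nhds
  add_mem' hx hy := by
    simpa only [Set.mem_ofPred_eq, map_add, smul_add, add_zero] using Tendsto.add hx hy
  smul_mem' a x hx := by
    simpa only [Set.mem_ofPred_eq, map_smul, smul_comm _ a, smul_zero] using Tendsto.const_smul hx a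

theorem mem_decaySubmodule {x : E} :
    x ∈ decaySubmodule T ν ↔ Tendsto (fun n : ℕ => ν⁻¹ ^ n • (T ^ n) x) atTop (𝓝 0) :=
  Iff.rfl

theorem maxGenEigenspace_le_decaySubmodule {μ : ℂ} (h : T.HasEigenvalue μ → ‖μ‖ < ‖ν‖) :
    T.maxGenEigenspace μ ≤ decaySubmodule T ν := by
  by_cases hμ : T.HasEigenvalue μ
  · intro x hx
    obtain ⟨k, hk⟩ := (Module.End.mem_maxGenEigenspace T μ x).1 hx
    have hlim := tendsto_finsetSum (range k) fun j _ =>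
      (tendsto_inv_pow_mul_choose_mul_pow (h hμ) j).smul_const
        (((T - μ • (1 : Module.End ℂ E)) ^ j) x)
    simp only [zero_smul, Finset.sum_const_zero] at hlim
    rw [mem_decaySubmodule]
    refine hlim.congr fun n => ?_
    rw [pow_apply_eq_sum_of_sub_smul_pow_apply_eq_zero hk, Finset.smul_sum]
    simp only [smul_smul]
  · have hbot : T.maxGenEigenspace μ = ⊥ :=
      not_not.1 fun hne => hμ (Module.End.HasUnifEigenvalue.lt zero_lt_one hne)
    rw [hbot]
    exact bot_le

theorem decaySubmodule_eq_top [FiniteDimensional ℂ E]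
    (h : ∀ μ, T.HasEigenvalue μ → ‖μ‖ < ‖ν‖) : decaySubmodule T ν = ⊤ := by
  rw [eq_top_iff, ← Module.End.iSup_maxGenEigenspace_eq_top T]
  exact iSup_le fun μ => maxGenEigenspace_le_decaySubmodule (h μ)

theorem decaySubmodule_ne_top [T1Space E] (hν₀ : ν ≠ 0) (hν : T.HasEigenvalue ν) :
    decaySubmodule T ν ≠ ⊤ := by
  obtain ⟨v, hv⟩ := hν.exists_hasEigenvector
  intro htop
  have hlim : Tendsto (fun n : ℕ => ν⁻¹ ^ n • (T ^ n) v) atTop (𝓝 0) :=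
    mem_decaySubmodule.1 (htop ▸ Submodule.mem_top)
  refine hv.2 (tendsto_const_nhds_iff.1 (hlim.congr fun n => ?_))
  rw [hv.pow_apply, smul_smul, ← mul_pow, inv_mul_cancel₀ hν₀, one_pow, one_smul]

variable {r : ℝ}

theorem tendsto_smul_pow_apply_of_sub_smul_pow_succ_apply_eq_zero (hr : r ≠ 0) {m : ℕ} {y : E}
    (hy : ((T - (r : ℂ) • (1 : Module.End ℂ E)) ^ (m + 1)) y = 0) :
    Tendsto (fun n : ℕ => (((n.choose m : ℝ)⁻¹ * r ^ m * r⁻¹ ^ n : ℝ) : ℂ) • (T ^ n) y) atTop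
      (𝓝 (((T - (r : ℂ) • (1 : Module.End ℂ E)) ^ m) y)) := by
  let N : Module.End ℂ E := T - (r : ℂ) • (1 : Module.End ℂ E)
  have hterm : ∀ j ∈ range (m + 1), Tendsto
      (fun n : ℕ => (((n.choose j : ℝ) / n.choose m * r ^ (m - j) : ℝ) : ℂ) • (N ^ j) y) atTop
      (𝓝 ((((if j = m then 1 else 0) * r ^ (m - j) : ℝ) : ℂ) • (N ^ j) y)) := fun j hj =>
    ((Complex.continuous_ofReal.tendsto _).comp
      ((tendsto_choose_div_choose (Finset.mem_range_succ_iff.1 hj)).mul_const _)).smul_const _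
  have hlim := tendsto_finsetSum _ hterm
  simp only [ite_mul, one_mul, zero_mul, apply_ite Complex.ofReal, Complex.ofReal_zero, ite_smul,
    zero_smul, Finset.sum_ite_eq', Finset.self_mem_range_succ, if_true, Nat.sub_self, pow_zero,
    Complex.ofReal_one, one_smul] at hlim
  refine hlim.congr' ?_
  filter_upwards [eventually_ge_atTop m] with n hn
  rw [pow_apply_eq_sum_of_sub_smul_pow_apply_eq_zero hy, Finset.smul_sum]
  refine Finset.sum_congr rfl fun j hj => ?_
  have hjm : j ≤ m := Finset.mem_range_succ_iff.1 hj
  have hpow : r ^ (m - j) = r ^ m * r⁻¹ ^ n * r ^ (n - j) := by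
    rw [inv_pow, pow_sub₀ r hr hjm, pow_sub₀ r hr (hjm.trans hn)]
    field_simp
  rw [hpow, smul_smul]
  congr 1
  push_cast
  ring

theorem exists_tendstoInDirection_pow_apply (hr : 0 < r) {y z : E}
    (hy : y ∈ T.maxGenEigenspace r) (hy₀ : y ≠ 0) (hz : z ∈ decaySubmodule T r) :
    ∃ u, T u = (r : ℂ) • u ∧ TendstoInDirection (fun n => (T ^ n) (y + z)) u := by
  obtain ⟨m, hm, hm'⟩ := exists_sub_smul_pow_apply_ne_zero hy hy₀
  refine ⟨((T - (r : ℂ) • (1 : Module.End ℂ E)) ^ m) y, ?_, hm,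
    fun n => (n.choose m : ℝ)⁻¹ * r ^ m * r⁻¹ ^ n, ?_, ?_⟩
  · rw [pow_succ', Module.End.mul_apply] at hm'
    simpa [sub_eq_zero] using hm'
  · filter_upwards [eventually_ge_atTop m] with n hn
    have hchoose := Nat.choose_pos hn
    positivity
  · have hchoose : Tendsto (fun n : ℕ => (((n.choose m : ℝ)⁻¹ * r ^ m : ℝ) : ℂ)) atTop
        (𝓝 (((if 0 = m then 1 else 0) * r ^ m : ℝ) : ℂ)) := by
      refine (Complex.continuous_ofReal.tendsto _).comp (Tendsto.mul_const _ ?_)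
      simpa using tendsto_choose_div_choose m.zero_le
    have hlim := (tendsto_smul_pow_apply_of_sub_smul_pow_succ_apply_eq_zero hr.ne' hm').add
      (hchoose.smul (mem_decaySubmodule.1 hz))
    simp only [smul_zero, add_zero] at hlim
    refine hlim.congr fun n => ?_
    simp only [map_add, smul_add, smul_smul]
    push_cast
    rfl

theorem exists_tendstoInDirection_of_notMem_decaySubmodule [FiniteDimensional ℂ E] (hr : 0 < r)
    (hdom : ∀ μ, T.HasEigenvalue μ → μ ≠ r → ‖μ‖ < r) {x : E} (hx : x ∉ decaySubmodule T r) :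
    ∃ u, T u = (r : ℂ) • u ∧ TendstoInDirection (fun n => (T ^ n) x) u := by
  have hle : ⨆ μ, T.maxGenEigenspace μ ≤ T.maxGenEigenspace r ⊔ decaySubmodule T r := by
    refine iSup_le fun μ => ?_
    by_cases h : μ = r
    · exact h ▸ le_sup_left
    · refine le_sup_of_le_right (maxGenEigenspace_le_decaySubmodule fun hμ => ?_)
      rw [Complex.norm_of_nonneg hr.le]
      exact hdom μ hμ h
  rw [Module.End.iSup_maxGenEigenspace_eq_top T] at hle
  obtain ⟨y, hy, z, hz, rfl⟩ := Submodule.mem_sup.1 (hle (Submodule.mem_top (x := x)))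
  refine exists_tendstoInDirection_pow_apply hr hy ?_ hz
  rintro rfl
  exact hx (by rwa [zero_add])

theorem eventually_exists_tendstoInDirection_one_sub_smul_pow [T1Space E] [FiniteDimensional ℂ E]
    {B : Module.End ℂ E} {c : ℝ} (hBc : B.HasEigenvalue c)
    (hc : ∀ κ, B.HasEigenvalue κ → κ ≠ c → c < κ.re) :
    ∀ᶠ h : ℝ in 𝓝[>] 0, ∃ F : Submodule ℂ E, F ≠ ⊤ ∧ ∀ x ∉ F, ∃ u, B u = (c : ℂ) • u ∧
      TendstoInDirection (fun n => ((1 - (h : ℂ) • B) ^ n) x) u := by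
  have hstep : ∀ᶠ h : ℝ in 𝓝[>] 0, 0 < 1 - h * c :=
    nhdsWithin_le_nhds <| (by fun_prop : Continuous fun h : ℝ => 1 - h * c).tendsto 0
      |>.eventually_const_lt (by simp)
  filter_upwards [hstep, eventually_norm_lt_of_hasEigenvalue_one_sub_smul hc, self_mem_nhdsWithin]
    with h hν hdom (hpos : 0 < h)
  have heig : (1 - (h : ℂ) • B).eigenspace ((1 - h * c : ℝ) : ℂ) = B.eigenspace c := by
    rw [← eigenspace_one_sub_smul B (Complex.ofReal_ne_zero.2 hpos.ne')]
    push_cast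
    rfl
  refine ⟨decaySubmodule (1 - (h : ℂ) • B) ((1 - h * c : ℝ) : ℂ),
    decaySubmodule_ne_top (Complex.ofReal_ne_zero.2 hν.ne') ?_, fun x hx => ?_⟩
  · rwa [Module.End.hasEigenvalue_iff, heig, ← Module.End.hasEigenvalue_iff]
  · obtain ⟨u, hu, hlim⟩ := exists_tendstoInDirection_of_notMem_decaySubmodule hν hdom hx
    exact ⟨u, Module.End.mem_eigenspace_iff.1 (heig ▸ Module.End.mem_eigenspace_iff.2 hu), hlim⟩

end PowerIteration

section MatrixSpectrum

variable {n : Type*} [Fintype n] [DecidableEq n]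

theorem mem_spectrum_iff_exists_mulVec {F : Type*} [Field F] {M : Matrix n n F} {μ : F} :
    μ ∈ spectrum F M ↔ ∃ v : n → F, v ≠ 0 ∧ M.mulVec v = μ • v := by
  rw [← Matrix.spectrum_toLin', ← Module.End.hasEigenvalue_iff_mem_spectrum]
  refine ⟨fun h => ?_, fun ⟨v, hv₀, hv⟩ => ?_⟩
  · obtain ⟨v, hv⟩ := h.exists_hasEigenvector
    exact ⟨v, hv.2, hv.apply_eq_smul⟩
  · exact Module.End.hasEigenvalue_of_hasEigenvector ⟨Module.End.mem_eigenspace_iff.2 hv, hv₀⟩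

theorem mem_spectrum_iff_exists_vecMul {F : Type*} [Field F] {M : Matrix n n F} {μ : F} :
    μ ∈ spectrum F M ↔ ∃ v : n → F, v ≠ 0 ∧ Matrix.vecMul v M = μ • v := by
  simp only [← Matrix.mulVec_transpose, ← mem_spectrum_iff_exists_mulVec,
    Matrix.mem_spectrum_iff_isRoot_charpoly, Matrix.charpoly_transpose]

theorem map_mem_spectrum_map_iff {F L : Type*} [Field F] [Field L] (f : F →+* L)
    {M : Matrix n n F} {μ : F} : f μ ∈ spectrum L (M.map f) ↔ μ ∈ spectrum F M := by
  rw [Matrix.mem_spectrum_iff_isRoot_charpoly, Matrix.mem_spectrum_iff_isRoot_charpoly,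
    Matrix.charpoly_map, Polynomial.isRoot_map_iff f.injective]

theorem ofReal_mem_spectrum_map_iff {A : Matrix n n ℝ} {t : ℝ} :
    (t : ℂ) ∈ spectrum ℂ (A.map Complex.ofReal) ↔ t ∈ spectrum ℝ A :=
  map_mem_spectrum_map_iff Complex.ofRealHom

theorem conj_mem_spectrum_map_ofReal_iff {A : Matrix n n ℝ} {μ : ℂ} :
    starRingEnd ℂ μ ∈ spectrum ℂ (A.map Complex.ofReal) ↔
      μ ∈ spectrum ℂ (A.map Complex.ofReal) := by
  rw [← map_mem_spectrum_map_iff (starRingEnd ℂ) (μ := μ), Matrix.map_map]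
  simp only [Function.comp_def, Complex.conj_ofReal]

theorem mem_spectrum_one_sub_iff {M : Matrix n n ℂ} {μ : ℂ} :
    μ ∈ spectrum ℂ (1 - M) ↔ 1 - μ ∈ spectrum ℂ M := by
  rw [← map_one (algebraMap ℂ (Matrix n n ℂ)), ← spectrum.singleton_sub_eq, Set.singleton_sub]
  exact ⟨fun ⟨ν, hν, h⟩ => by rwa [← h, sub_sub_cancel], fun h => ⟨1 - μ, h, sub_sub_cancel 1 μ⟩⟩

theorem IsLowestEigenvalue.one_sub {M : Matrix n n ℂ} {l : ℂ} (h : IsLowestEigenvalue M l) :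
    IsHighestEigenvalue (1 - M) (1 - l) := by
  refine ⟨mem_spectrum_one_sub_iff.2 (by rw [sub_sub_cancel]; exact h.1), fun m hm => ?_⟩
  have hle := h.2 _ (mem_spectrum_one_sub_iff.1 hm)
  rw [Complex.sub_re] at hle ⊢
  linarith

theorem IsHighestEigenvalue.one_sub {M : Matrix n n ℂ} {l : ℂ} (h : IsHighestEigenvalue M l) :
    IsLowestEigenvalue (1 - M) (1 - l) := by
  refine ⟨mem_spectrum_one_sub_iff.2 (by rw [sub_sub_cancel]; exact h.1), fun m hm => ?_⟩
  have hle := h.2 _ (mem_spectrum_one_sub_iff.1 hm)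
  rw [Complex.sub_re] at hle ⊢
  linarith

theorem IsLowestEigenvalue.re_mem_Icc {M : Matrix n n ℂ} {l₁ lN μ : ℂ}
    (hl₁ : IsLowestEigenvalue M l₁) (hlN : IsHighestEigenvalue M lN) (hμ : μ ∈ spectrum ℂ M) :
    μ.re ∈ Set.Icc l₁.re lN.re :=
  ⟨hl₁.2 μ hμ, hlN.2 μ hμ⟩

theorem IsLowestEigenvalue.card_mul_re_le_trace_re {M : Matrix n n ℂ} {l : ℂ}
    (h : IsLowestEigenvalue M l) : Fintype.card n * l.re ≤ M.trace.re := by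
  have hle : Multiset.card (M.charpoly.roots.map Complex.re) • l.re ≤
      (M.charpoly.roots.map Complex.re).sum := by
    refine Multiset.card_nsmul_le_sum fun x hx => ?_
    obtain ⟨μ, hμ, rfl⟩ := Multiset.mem_map.1 hx
    exact h.2 μ (Matrix.mem_spectrum_iff_isRoot_charpoly.2 (Polynomial.mem_roots'.1 hμ).2)
  have hsum : (M.charpoly.roots.map Complex.re).sum = M.trace.re := by
    rw [Matrix.trace_eq_sum_roots_charpoly]
    exact (map_multiset_sum Complex.reAddGroupHom _).symm
  rwa [hsum, Multiset.card_map, (IsAlgClosed.splits M.charpoly).natDegree_eq_card_roots.symm,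
    Matrix.charpoly_natDegree_eq_dim, nsmul_eq_mul] at hle

end MatrixSpectrum

section PerronFrobenius

theorem monotone_mulVec {m n R : Type*} [Fintype n] [Semiring R] [PartialOrder R] [IsOrderedRing R]
    {A : Matrix m n R} (hA : ∀ i j, 0 ≤ A i j) : Monotone A.mulVec := fun _ _ hxy i =>
  Finset.sum_le_sum fun j _ => mul_le_mul_of_nonneg_left (hxy j) (hA i j)

variable {n : Type*} [Fintype n] {A : Matrix n n ℝ}

theorem norm_smul_norm_le_mulVec_norm (hA : ∀ i j, 0 ≤ A i j) {μ : ℂ} {v : n → ℂ}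
    (hv : (A.map Complex.ofReal).mulVec v = μ • v) :
    ‖μ‖ • (fun i => ‖v i‖) ≤ A.mulVec fun i => ‖v i‖ := fun i =>
  calc ‖μ‖ * ‖v i‖ = ‖(A.map Complex.ofReal).mulVec v i‖ := by
        rw [hv, Pi.smul_apply, norm_smul]
    _ ≤ ∑ j, ‖(A i j : ℂ) * v j‖ := norm_sum_le _ _
    _ = A.mulVec (fun i => ‖v i‖) i := Finset.sum_congr rfl fun j _ => by
        rw [norm_mul, Complex.norm_of_nonneg (hA i j)]

variable [DecidableEq n]

theorem toLin'_map_ofReal_pow_apply (A : Matrix n n ℝ) (k : ℕ) (d : n → ℝ) :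
    (Matrix.toLin' (A.map Complex.ofReal) ^ k) (Complex.ofReal ∘ d) =
      Complex.ofReal ∘ (A ^ k).mulVec d := by
  have hpow : (A ^ k).map Complex.ofReal = A.map Complex.ofReal ^ k :=
    map_pow Complex.ofRealHom.mapMatrix A k
  rw [← Matrix.toLin'_pow, Matrix.toLin'_apply, ← hpow]
  exact (funext fun i => RingHom.map_mulVec Complex.ofRealHom (A ^ k) d i).symm

theorem pow_mulVec_le_pow_smul (hA : ∀ i j, 0 ≤ A i j) {t : ℝ} (ht : 0 ≤ t) {d : n → ℝ}
    (hd : A.mulVec d ≤ t • d) (k : ℕ) : (A ^ k).mulVec d ≤ t ^ k • d := by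
  induction k with
  | zero => rw [pow_zero, pow_zero, Matrix.one_mulVec, one_smul]
  | succ k ih =>
    calc (A ^ (k + 1)).mulVec d = A.mulVec ((A ^ k).mulVec d) := by
          rw [pow_succ', Matrix.mulVec_mulVec]
      _ ≤ A.mulVec (t ^ k • d) := monotone_mulVec hA ih
      _ = t ^ k • A.mulVec d := Matrix.mulVec_smul A _ d
      _ ≤ t ^ k • t • d := smul_le_smul_of_nonneg_left hd (pow_nonneg ht k)
      _ = t ^ (k + 1) • d := by rw [smul_smul, pow_succ]

theorem nonneg_of_mulVec_le_smul (hA : ∀ i j, 0 ≤ A i j) {t : ℝ} (ht : 0 < t)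
    (hspec : ∀ μ ∈ spectrum ℂ (A.map Complex.ofReal), ‖μ‖ < t) {d : n → ℝ}
    (hd : A.mulVec d ≤ t • d) : 0 ≤ d := by
  have hdecay : Complex.ofReal ∘ d ∈
      decaySubmodule (Matrix.toLin' (A.map Complex.ofReal)) (t : ℂ) := by
    rw [decaySubmodule_eq_top fun μ hμ => ?_]
    · exact Submodule.mem_top
    · rw [Complex.norm_of_nonneg ht.le]
      rw [Module.End.hasEigenvalue_iff_mem_spectrum, Matrix.spectrum_toLin'] at hμ
      exact hspec μ hμ
  intro i
  have hlim : Tendsto (fun k : ℕ => t⁻¹ ^ k * (A ^ k).mulVec d i) atTop (𝓝 0) := by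
    have hi := (Complex.continuous_re.tendsto _).comp
      (tendsto_pi_nhds.1 (mem_decaySubmodule.1 hdecay) i)
    simp only [toLin'_map_ofReal_pow_apply] at hi
    refine hi.congr fun k => ?_
    rw [Function.comp_apply, Pi.smul_apply, Function.comp_apply, smul_eq_mul, ← Complex.ofReal_inv,
      ← Complex.ofReal_pow, ← Complex.ofReal_mul, Complex.ofReal_re]
  refine le_of_tendsto hlim (Eventually.of_forall fun k => ?_)
  rw [inv_pow, inv_mul_le_iff₀ (pow_pos ht k)]
  exact pow_mulVec_le_pow_smul hA ht.le hd k i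

theorem le_sub_smul_resolvent_mulVec (hA : ∀ i j, 0 ≤ A i j) {ρ t : ℝ} (hρ : 0 ≤ ρ) (hρt : ρ < t)
    (hspec : ∀ μ ∈ spectrum ℂ (A.map Complex.ofReal), ‖μ‖ ≤ ρ) {p : n → ℝ}
    (hp : ρ • p ≤ A.mulVec p) : p ≤ (t - ρ) • (resolvent A t).mulVec p := by
  have ht : 0 < t := hρ.trans_lt hρt
  have ht_mem : t ∉ spectrum ℝ A := fun hmem => hρt.not_ge <| by
    simpa only [Complex.norm_of_nonneg ht.le] using hspec t (ofReal_mem_spectrum_map_iff.2 hmem)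
  have hq : A.mulVec ((resolvent A t).mulVec p) = t • (resolvent A t).mulVec p - p := by
    have h := Ring.mul_inverse_cancel _ (spectrum.notMem_iff.1 ht_mem)
    rw [sub_mul, sub_eq_iff_eq_add, ← sub_eq_iff_eq_add'] at h
    rw [Matrix.mulVec_mulVec, resolvent, ← h, Matrix.sub_mulVec, Matrix.one_mulVec,
      ← Matrix.mulVec_mulVec, Algebra.algebraMap_eq_smul_one, Matrix.smul_mulVec, Matrix.one_mulVec]
  rw [← sub_nonneg]
  refine nonneg_of_mulVec_le_smul hA ht (fun μ hμ => (hspec μ hμ).trans_lt hρt) ?_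
  rw [Matrix.mulVec_sub, Matrix.mulVec_smul, hq]
  intro i
  have hi := hp i
  simp only [Pi.sub_apply, Pi.smul_apply, smul_eq_mul] at hi ⊢
  linarith

open scoped Matrix.Norms.Operator in
theorem tendsto_sub_smul_resolvent_mulVec {ρ : ℝ} (hρ : ρ ∉ spectrum ℝ A) (p : n → ℝ) :
    Tendsto (fun t => (t - ρ) • (resolvent A t).mulVec p) (𝓝 ρ) (𝓝 0) := by
  have hres : ContinuousAt (resolvent A) ρ :=
    (spectrum.hasDerivAt_resolvent_const_left (not_not.1 hρ)).continuousAt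
  have hmulVec : Continuous fun B : Matrix n n ℝ => B.mulVec p :=
    continuous_id.matrix_mulVec continuous_const
  have hsub : Tendsto (fun t : ℝ => t - ρ) (𝓝 ρ) (𝓝 0) :=
    sub_self ρ ▸ (continuous_sub_right ρ).tendsto ρ
  have hlim := hsub.smul ((hmulVec.tendsto _).comp hres)
  rwa [zero_smul] at hlim

theorem norm_mem_spectrum_of_forall_norm_le (hA : ∀ i j, 0 ≤ A i j) {μ : ℂ}
    (hμ : μ ∈ spectrum ℂ (A.map Complex.ofReal))
    (hmax : ∀ ν ∈ spectrum ℂ (A.map Complex.ofReal), ‖ν‖ ≤ ‖μ‖) : ‖μ‖ ∈ spectrum ℝ A := by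
  by_contra hnot
  obtain ⟨v, hv₀, hv⟩ := mem_spectrum_iff_exists_mulVec.1 hμ
  have hlim := (tendsto_sub_smul_resolvent_mulVec hnot fun i => ‖v i‖).mono_left
    (nhdsWithin_le_nhds (s := Set.Ioi ‖μ‖))
  have hle : (fun i => ‖v i‖) ≤ 0 :=
    ge_of_tendsto hlim <| eventually_nhdsWithin_of_forall fun _ ht =>
      le_sub_smul_resolvent_mulVec hA (norm_nonneg μ) ht hmax (norm_smul_norm_le_mulVec_norm hA hv)
  exact hv₀ (funext fun i => norm_le_zero_iff.1 (hle i))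

theorem IsHighestEigenvalue.norm_le_re (hA : ∀ i j, 0 ≤ A i j) {l : ℂ}
    (hl : IsHighestEigenvalue (A.map Complex.ofReal) l) {μ : ℂ}
    (hμ : μ ∈ spectrum ℂ (A.map Complex.ofReal)) : ‖μ‖ ≤ l.re := by
  obtain ⟨ν, hν, hmax⟩ := Set.exists_max_image (spectrum ℂ (A.map Complex.ofReal)) norm
    (Matrix.finite_spectrum _) ⟨l, hl.1⟩
  have hnorm := norm_mem_spectrum_of_forall_norm_le hA hν hmax
  exact (hmax μ hμ).trans (hl.2 _ (ofReal_mem_spectrum_map_iff.2 hnorm))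

theorem IsHighestEigenvalue.re_nonneg (hA : ∀ i j, 0 ≤ A i j) {l : ℂ}
    (hl : IsHighestEigenvalue (A.map Complex.ofReal) l) : 0 ≤ l.re :=
  (norm_nonneg l).trans (hl.norm_le_re hA hl.1)

theorem IsHighestEigenvalue.eq_ofReal_re_of_re_eq (hA : ∀ i j, 0 ≤ A i j) {l : ℂ}
    (hl : IsHighestEigenvalue (A.map Complex.ofReal) l) {μ : ℂ}
    (hμ : μ ∈ spectrum ℂ (A.map Complex.ofReal)) (h : μ.re = l.re) : μ = l.re := by
  have hnorm : ‖μ‖ ≤ |μ.re| := (hl.norm_le_re hA hμ).trans (h ▸ le_abs_self μ.re)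
  have him := Complex.abs_re_eq_norm.1 (le_antisymm μ.abs_re_le_norm hnorm)
  exact Complex.ext h (by rw [him, Complex.ofReal_im])

theorem IsLowestEigenvalue.eq_ofReal_re {l : ℂ}
    (hl : IsLowestEigenvalue (A.map Complex.ofReal) l)
    (huniq : ∀ μ ∈ spectrum ℂ (A.map Complex.ofReal), μ.re = l.re → μ = l) : l = l.re :=
  (Complex.conj_eq_iff_re.1
    (huniq _ (conj_mem_spectrum_map_ofReal_iff.2 hl.1) (Complex.conj_re l))).symm

end PerronFrobenius

section Energy

variable {V : Type*} {G : Digraph V}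

theorem adjacency_of_adj {u v : V} (h : G.Adj u v) : adjacency G v u = 1 :=
  if_pos h

theorem adjacency_of_not_adj {u v : V} (h : ¬G.Adj u v) : adjacency G v u = 0 :=
  if_neg h

theorem adjacency_nonneg (i j : V) : 0 ≤ adjacency G i j := by
  by_cases h : G.Adj j i
  · exact (adjacency_of_adj h).symm ▸ zero_le_one
  · exact (adjacency_of_not_adj h).ge

variable [Fintype V]

theorem inDegree_pos_of_adj {u v : V} (h : G.Adj u v) : 0 < inDegree G v :=
  Finset.sum_pos' (fun j _ => adjacency_nonneg v j)
    ⟨u, Finset.mem_univ u, (adjacency_of_adj h).symm ▸ one_pos⟩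

theorem outDegree_pos_of_adj {u v : V} (h : G.Adj u v) : 0 < outDegree G u :=
  Finset.sum_pos' (fun i _ => adjacency_nonneg i u)
    ⟨v, Finset.mem_univ v, (adjacency_of_adj h).symm ▸ one_pos⟩

/-- Every vertex has an incoming and an outgoing edge, so that the rescalings by inverse square
roots of degrees in `sna` and `dirichletEnergy` do not divide by zero. -/
def HasPosDegrees (G : Digraph V) : Prop :=
  ∀ v, 0 < inDegree G v ∧ 0 < outDegree G v

theorem StronglyConnected.hasPosDegrees (hG : StronglyConnected G) (h : ∃ u v, G.Adj u v) :
    HasPosDegrees G := by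
  obtain ⟨a, b, hab⟩ := h
  intro v
  obtain ⟨c, -, hcv⟩ := Relation.TransGen.tail'_iff.1 (.trans_left (.single hab) (hG b v))
  obtain ⟨d, hvd, -⟩ := Relation.TransGen.head'_iff.1 (.trans_right (hG v a) (.single hab))
  exact ⟨inDegree_pos_of_adj hcv, outDegree_pos_of_adj hvd⟩

theorem HasPosDegrees.sum_adjacency_div_inDegree (hG : HasPosDegrees G) (i : V) :
    ∑ j, adjacency G i j / inDegree G i = 1 := by
  rw [← Finset.sum_div]
  exact div_self (hG i).1.ne'

theorem HasPosDegrees.sum_adjacency_div_outDegree (hG : HasPosDegrees G) (j : V) :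
    ∑ i, adjacency G i j / outDegree G j = 1 := by
  rw [← Finset.sum_div]
  exact div_self (hG j).2.ne'

variable {K : ℕ}

open scoped Matrix.Norms.Frobenius in
theorem frobenius_eq_norm (x : Matrix V (Fin K) ℂ) : frobenius x = ‖x‖ := by
  rw [Matrix.frobenius_norm_def, ← Real.sqrt_eq_rpow, frobenius]
  simp only [Real.rpow_two]

open scoped Matrix.Norms.Frobenius in
theorem frobenius_ne_zero {x : Matrix V (Fin K) ℂ} (hx : x ≠ 0) : frobenius x ≠ 0 :=
  frobenius_eq_norm x ▸ norm_ne_zero_iff.2 hx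

open scoped Matrix.Norms.Frobenius in
theorem continuous_frobenius : Continuous (frobenius : Matrix V (Fin K) ℂ → ℝ) :=
  continuous_norm.congr fun x => (frobenius_eq_norm x).symm

open scoped Matrix.Norms.Frobenius in
theorem frobenius_smul (c : ℝ) (x : Matrix V (Fin K) ℂ) :
    frobenius (c • x) = |c| * frobenius x := by
  rw [frobenius_eq_norm, frobenius_eq_norm, norm_smul, Real.norm_eq_abs]

theorem frobenius_sq (x : Matrix V (Fin K) ℂ) : frobenius x ^ 2 = ∑ i, ∑ k, ‖x i k‖ ^ 2 :=
  Real.sq_sqrt (Finset.sum_nonneg fun _ _ => Finset.sum_nonneg fun _ _ => sq_nonneg _)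

theorem normalized_smul {c : ℝ} (hc : 0 < c) (x : Matrix V (Fin K) ℂ) :
    normalized (c • x) = normalized x := by
  rw [normalized, frobenius_smul, abs_of_pos hc, smul_smul, mul_inv_rev, mul_assoc,
    inv_mul_cancel₀ hc.ne', mul_one, normalized]

theorem frobenius_normalized {x : Matrix V (Fin K) ℂ} (hx : x ≠ 0) :
    frobenius (normalized x) = 1 := by
  have hnonneg : 0 ≤ frobenius x := Real.sqrt_nonneg _
  rw [normalized, frobenius_smul, abs_inv, abs_of_nonneg hnonneg,
    inv_mul_cancel₀ (frobenius_ne_zero hx)]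

theorem continuousAt_normalized {x : Matrix V (Fin K) ℂ} (hx : x ≠ 0) :
    ContinuousAt normalized x :=
  (continuous_frobenius.continuousAt.inv₀ (frobenius_ne_zero hx)).smul continuousAt_id

theorem dirichletEnergy_nonneg (x : Matrix V (Fin K) ℂ) : 0 ≤ dirichletEnergy G x :=
  mul_nonneg (by norm_num) <| Finset.sum_nonneg fun i _ => Finset.sum_nonneg fun j _ =>
    mul_nonneg (adjacency_nonneg i j) <| Finset.sum_nonneg fun _ _ => sq_nonneg _

theorem continuous_dirichletEnergy :
    Continuous (dirichletEnergy G : Matrix V (Fin K) ℂ → ℝ) := by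
  unfold dirichletEnergy
  fun_prop

theorem re_trace_conjTranspose_mul_self (x : Matrix V (Fin K) ℂ) :
    (x.conjTranspose * x).trace.re = frobenius x ^ 2 := by
  rw [frobenius_sq, Finset.sum_comm]
  simp only [Matrix.trace, Matrix.diag_apply, Matrix.mul_apply, Matrix.conjTranspose_apply,
    Complex.re_sum, Complex.star_def, ← Complex.normSq_eq_conj_mul_self, Complex.ofReal_re,
    Complex.sq_norm]

theorem re_trace_conjTranspose_mul_mul (M : Matrix V V ℂ) (x : Matrix V (Fin K) ℂ) :
    (x.conjTranspose * M * x).trace.re = ∑ i, ∑ j, ∑ k, (star (x i k) * M i j * x j k).re := by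
  simp only [Matrix.trace, Matrix.diag_apply, Matrix.mul_apply, Matrix.conjTranspose_apply,
    Finset.sum_mul, Complex.re_sum]
  rw [Finset.sum_comm]
  simp_rw [Finset.sum_comm (s := (Finset.univ : Finset (Fin K)))]
  rw [Finset.sum_comm]

variable [DecidableEq V]

theorem sna_apply (i j : V) :
    sna G i j = (√(inDegree G i))⁻¹ * adjacency G i j * (√(outDegree G j))⁻¹ := by
  rw [sna, Matrix.mul_diagonal, Matrix.diagonal_mul]

theorem sna_nonneg (i j : V) : 0 ≤ sna G i j := by
  rw [sna_apply]
  have hadj := adjacency_nonneg (G := G) i j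
  positivity

theorem snaC_eq_zero_of_forall_not_adj (h : ∀ u v, ¬G.Adj u v) : snaC G = 0 := by
  ext i j
  rw [snaC, Matrix.map_apply, sna_apply, adjacency_of_not_adj (h j i), mul_zero, zero_mul]
  rfl

theorem trace_snaC_of_forall_not_adj_self (h : ∀ v, ¬G.Adj v v) : (snaC G).trace = 0 :=
  Finset.sum_eq_zero fun i _ => by
    rw [Matrix.diag_apply, snaC, Matrix.map_apply, sna_apply, adjacency_of_not_adj (h i), mul_zero,
      zero_mul, Complex.ofReal_zero]

theorem adjacency_mul_norm_div_sub_div_sq (i j : V) (a b : ℂ) :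
    adjacency G i j * ‖a / (√(inDegree G i) : ℂ) - b / (√(outDegree G j) : ℂ)‖ ^ 2 =
      adjacency G i j / inDegree G i * ‖a‖ ^ 2 + adjacency G i j / outDegree G j * ‖b‖ ^ 2 -
        2 * (star a * snaC G i j * b).re := by
  have hi : √(inDegree G i) ^ 2 = inDegree G i :=
    Real.sq_sqrt (Finset.sum_nonneg fun j _ => adjacency_nonneg i j)
  have hj : √(outDegree G j) ^ 2 = outDegree G j :=
    Real.sq_sqrt (Finset.sum_nonneg fun i _ => adjacency_nonneg i j)
  nth_rw 2 [← hi]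
  nth_rw 2 [← hj]
  simp only [snaC, Matrix.map_apply, sna_apply, Complex.sq_norm, Complex.normSq_apply,
    Complex.sub_re, Complex.sub_im, Complex.div_ofReal_re, Complex.div_ofReal_im, Complex.mul_re,
    Complex.mul_im, Complex.star_def, Complex.conj_re, Complex.conj_im, Complex.ofReal_re,
    Complex.ofReal_im]
  ring

theorem HasPosDegrees.dirichletEnergy_eq (hG : HasPosDegrees G) (x : Matrix V (Fin K) ℂ) :
    dirichletEnergy G x = (frobenius x ^ 2 - (x.conjTranspose * snaC G * x).trace.re) / 2 := by
  have hin : ∑ i, ∑ j, ∑ k, adjacency G i j / inDegree G i * ‖x i k‖ ^ 2 = frobenius x ^ 2 := by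
    simp only [← Finset.mul_sum, ← Finset.sum_mul, hG.sum_adjacency_div_inDegree, one_mul,
      frobenius_sq]
  have hout : ∑ i, ∑ j, ∑ k, adjacency G i j / outDegree G j * ‖x j k‖ ^ 2 = frobenius x ^ 2 := by
    rw [Finset.sum_comm]
    simp only [← Finset.mul_sum, ← Finset.sum_mul, hG.sum_adjacency_div_outDegree, one_mul,
      frobenius_sq]
  have hexpand : ∀ i j, adjacency G i j * ∑ k,
      ‖x i k / (√(inDegree G i) : ℂ) - x j k / (√(outDegree G j) : ℂ)‖ ^ 2 =
      ∑ k, adjacency G i j / inDegree G i * ‖x i k‖ ^ 2 +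
        ∑ k, adjacency G i j / outDegree G j * ‖x j k‖ ^ 2 -
        2 * ∑ k, (star (x i k) * snaC G i j * x j k).re := fun i j => by
    rw [Finset.mul_sum, Finset.mul_sum, ← Finset.sum_add_distrib, ← Finset.sum_sub_distrib]
    exact Finset.sum_congr rfl fun k _ => adjacency_mul_norm_div_sub_div_sq i j _ _
  simp only [dirichletEnergy, hexpand, Finset.sum_sub_distrib, Finset.sum_add_distrib, hin, hout,
    re_trace_conjTranspose_mul_mul]
  simp only [← Finset.mul_sum]
  ring

theorem HasPosDegrees.dirichletEnergy_of_mul_eq_smul (hG : HasPosDegrees G) {l : ℝ}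
    {x : Matrix V (Fin K) ℂ} (hx : snaC G * x = (l : ℂ) • x) :
    dirichletEnergy G x = (1 - l) / 2 * frobenius x ^ 2 := by
  rw [hG.dirichletEnergy_eq, Matrix.mul_assoc, hx, Matrix.mul_smul, Matrix.trace_smul, smul_eq_mul,
    Complex.re_ofReal_mul, re_trace_conjTranspose_mul_self]
  ring

theorem HasPosDegrees.isFrequencyDominant (hG : HasPosDegrees G) {l : ℝ}
    {x : ℕ → Matrix V (Fin K) ℂ} {u : Matrix V (Fin K) ℂ} (hu : snaC G * u = (l : ℂ) • u)
    (hx : TendstoInDirection x u) : IsFrequencyDominant G x (1 - l) := by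
  obtain ⟨hu₀, c, hc, hlim⟩ := hx
  have henergy : dirichletEnergy G (normalized u) = (1 - l) / 2 := by
    have hu' : snaC G * normalized u = (l : ℂ) • normalized u := by
      rw [normalized, Matrix.mul_smul, hu, smul_comm]
    rw [hG.dirichletEnergy_of_mul_eq_smul hu', frobenius_normalized hu₀, one_pow, mul_one]
  refine ⟨by linarith [dirichletEnergy_nonneg (G := G) (normalized u)], ?_⟩
  rw [← henergy]
  refine ((continuous_dirichletEnergy.continuousAt.comp
    (continuousAt_normalized hu₀)).tendsto.comp hlim).congr' ?_
  filter_upwards [hc] with n hn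
  simp only [Function.comp_apply, Complex.coe_smul, normalized_smul hn]

end Energy

section HeatOperator

variable {m n : Type*} [Fintype n] {W : Matrix n n ℝ} {u : Matrix m n ℂ}

theorem exists_mulVec_ne_zero_of_iSup_eigenspace_eq_top [DecidableEq n]
    (hW : ⨆ w : ℝ, Module.End.eigenspace (Matrix.toLin' W) w = ⊤) (hu : u ≠ 0) :
    ∃ (w : ℝ) (b : n → ℝ), W.mulVec b = w • b ∧ u.mulVec (Complex.ofReal ∘ b) ≠ 0 := by
  by_contra! h
  let φ : (n → ℝ) →ₗ[ℝ] m → ℂ :=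
    (Matrix.mulVecLin u).restrictScalars ℝ ∘ₗ (Complex.ofRealCLM : ℝ →ₗ[ℝ] ℂ).compLeft n
  have hφ : φ = 0 := by
    rw [← LinearMap.ker_eq_top, eq_top_iff, ← hW]
    exact iSup_le fun w b hb => h w b (Module.End.mem_eigenspace_iff.1 hb)
  refine hu (Matrix.ext_of_mulVec_single fun j => ?_)
  have hsingle : Complex.ofReal ∘ Pi.single j (1 : ℝ) = Pi.single j (1 : ℂ) :=
    funext fun i => by
      rw [Function.comp_apply, Pi.single_apply, Pi.single_apply, apply_ite Complex.ofReal,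
        Complex.ofReal_one, Complex.ofReal_zero]
  rw [Matrix.zero_mulVec, ← hsingle]
  exact LinearMap.congr_fun hφ (Pi.single j 1)

theorem mem_spectrum_of_mulVec_ofReal_ne_zero [DecidableEq n] {w : ℝ} {b : n → ℝ}
    (hb : W.mulVec b = w • b) (hub : u.mulVec (Complex.ofReal ∘ b) ≠ 0) : w ∈ spectrum ℝ W := by
  refine mem_spectrum_iff_exists_mulVec.2 ⟨b, ?_, hb⟩
  rintro rfl
  have hzero : Complex.ofReal ∘ (0 : n → ℝ) = 0 := funext fun _ => Complex.ofReal_zero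
  exact hub (by rw [hzero, Matrix.mulVec_zero])

variable [Fintype m] {M : Matrix m m ℂ}

/-- The operator `x ↦ M x W` on feature matrices, whose negative drives the heat equation. The
channel mixing `W` is kept real because its sign decides which frequency dominates. -/
def heatOperator (M : Matrix m m ℂ) (W : Matrix n n ℝ) : Module.End ℂ (Matrix m n ℂ) where
  toFun x := M * x * W.map Complex.ofReal
  map_add' x y := by rw [Matrix.mul_add, Matrix.add_mul]
  map_smul' a x := by rw [Matrix.mul_smul, Matrix.smul_mul, RingHom.id_apply]

theorem heatOperator_apply (x : Matrix m n ℂ) :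
    heatOperator M W x = M * x * W.map Complex.ofReal :=
  rfl

theorem heatOperator_vecMulVec (v : m → ℂ) (b : n → ℂ) :
    heatOperator M W (Matrix.vecMulVec v b) =
      Matrix.vecMulVec (M.mulVec v) (Matrix.vecMul b (W.map Complex.ofReal)) := by
  rw [heatOperator_apply, Matrix.mul_vecMulVec, Matrix.vecMulVec_mul]

theorem smul_mulVec_of_heatOperator_eq_smul {κ : ℂ}
    (hu : heatOperator M W u = κ • u) {w : ℝ} {b : n → ℝ} (hb : W.mulVec b = w • b) :
    (w : ℂ) • M.mulVec (u.mulVec (Complex.ofReal ∘ b)) = κ • u.mulVec (Complex.ofReal ∘ b) := by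
  have hbC : (W.map Complex.ofReal).mulVec (Complex.ofReal ∘ b) = (w : ℂ) • (Complex.ofReal ∘ b) :=
    funext fun i => (RingHom.map_mulVec Complex.ofRealHom W b i).symm.trans <| by
      rw [hb]
      exact Complex.ofReal_mul w (b i)
  rw [← Matrix.smul_mulVec κ u, ← hu, heatOperator_apply, ← Matrix.mulVec_mulVec, hbC,
    Matrix.mulVec_smul, Matrix.mulVec_mulVec]

variable [DecidableEq m] [DecidableEq n]

theorem hasEigenvalue_heatOperator {μ : ℂ} (hμ : μ ∈ spectrum ℂ M) {w : ℝ}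
    (hw : w ∈ spectrum ℝ W) : (heatOperator M W).HasEigenvalue (w * μ) := by
  obtain ⟨v, hv₀, hv⟩ := mem_spectrum_iff_exists_mulVec.1 hμ
  obtain ⟨b, hb₀, hb⟩ := mem_spectrum_iff_exists_vecMul.1 (ofReal_mem_spectrum_map_iff.2 hw)
  refine Module.End.hasEigenvalue_of_hasEigenvector (x := Matrix.vecMulVec v b)
    ⟨Module.End.mem_eigenspace_iff.2 ?_, ?_⟩
  · rw [heatOperator_vecMulVec, hv, hb, Matrix.smul_vecMulVec, Matrix.vecMulVec_smul, smul_smul,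
      mul_comm]
  · obtain ⟨i, hi⟩ := Function.ne_iff.1 hv₀
    obtain ⟨k, hk⟩ := Function.ne_iff.1 hb₀
    exact fun h => mul_ne_zero hi hk (congrFun (congrFun h i) k)

theorem exists_mem_spectrum_mul_eq_of_smul_mulVec_eq {a κ : ℂ} {y : m → ℂ} (hy₀ : y ≠ 0)
    (hy : a • M.mulVec y = κ • y) :
    ∃ μ ∈ spectrum ℂ M, κ = a * μ ∧ (a ≠ 0 → M.mulVec y = μ • y) := by
  rcases eq_or_ne a 0 with rfl | ha
  · have hnonempty : Nonempty m := (Function.ne_iff.1 hy₀).nonempty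
    obtain ⟨μ, hμ⟩ := spectrum.nonempty_of_isAlgClosed_of_finiteDimensional ℂ M
    rw [zero_smul, eq_comm, smul_eq_zero_iff_left hy₀] at hy
    exact ⟨μ, hμ, by rw [hy, zero_mul], fun h => absurd rfl h⟩
  · have hyM : M.mulVec y = (a⁻¹ * κ) • y := by rw [mul_smul, ← hy, inv_smul_smul₀ ha]
    exact ⟨a⁻¹ * κ, mem_spectrum_iff_exists_mulVec.2 ⟨y, hy₀, hyM⟩,
      (mul_inv_cancel_left₀ ha κ).symm, fun _ => hyM⟩

theorem exists_eq_mul_of_hasEigenvalue_heatOperator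
    (hW : ⨆ w : ℝ, Module.End.eigenspace (Matrix.toLin' W) w = ⊤) {κ : ℂ}
    (hκ : (heatOperator M W).HasEigenvalue κ) :
    ∃ w ∈ spectrum ℝ W, ∃ μ ∈ spectrum ℂ M, κ = w * μ := by
  obtain ⟨u, hu⟩ := hκ.exists_hasEigenvector
  obtain ⟨w, b, hb, hub⟩ := exists_mulVec_ne_zero_of_iSup_eigenspace_eq_top hW hu.2
  obtain ⟨μ, hμ, hκμ, -⟩ := exists_mem_spectrum_mul_eq_of_smul_mulVec_eq hub
    (smul_mulVec_of_heatOperator_eq_smul hu.apply_eq_smul hb)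
  exact ⟨w, mem_spectrum_of_mulVec_ofReal_ne_zero hb hub, μ, hμ, hκμ⟩

theorem mul_eq_smul_of_heatOperator_eq_smul
    (hW : ⨆ w : ℝ, Module.End.eigenspace (Matrix.toLin' W) w = ⊤) {κ l : ℂ}
    (hl : ∀ w ∈ spectrum ℝ W, ∀ μ ∈ spectrum ℂ M, κ = w * μ → w ≠ 0 ∧ μ = l)
    (hu : heatOperator M W u = κ • u) : M * u = l • u := by
  by_contra! hne
  obtain ⟨w, b, hb, hub⟩ :=
    exists_mulVec_ne_zero_of_iSup_eigenspace_eq_top hW (sub_ne_zero.2 hne)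
  rw [Matrix.sub_mulVec, ← Matrix.mulVec_mulVec, Matrix.smul_mulVec] at hub
  have hy₀ : u.mulVec (Complex.ofReal ∘ b) ≠ 0 := fun h => hub <| by
    rw [h, Matrix.mulVec_zero, smul_zero, sub_zero]
  obtain ⟨μ, hμ, hκμ, hy⟩ := exists_mem_spectrum_mul_eq_of_smul_mulVec_eq hy₀
    (smul_mulVec_of_heatOperator_eq_smul hu hb)
  obtain ⟨hw, rfl⟩ := hl w (mem_spectrum_of_mulVec_ofReal_ne_zero hb hy₀) μ hμ hκμ
  exact hub (sub_eq_zero.2 (hy (Complex.ofReal_ne_zero.2 hw)))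

end HeatOperator

section FrequencySelection

/-- Among the products `w * μ` of a channel weight `w ∈ S` with an eigenvalue `μ ∈ T`, the smallest
real part is `c`, and it is attained only at `μ = l` with a nonzero weight. For `S` and `T` the
spectra of `W` and `M`, this makes the Euler scheme of `x' = -M x W` pick out the eigenvalue `l` of
`M`. -/
structure SelectsEigenvalue (S : Set ℝ) (T : Set ℂ) (l c : ℝ) : Prop where
  mem : (l : ℂ) ∈ T
  exists_mul_eq : ∃ w ∈ S, w * l = c
  lt_or_eq : ∀ w ∈ S, ∀ μ ∈ T, c < w * μ.re ∨ w * μ.re = c ∧ w ≠ 0 ∧ μ = l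

theorem ae_of_notMem_submodule {m n : Type*} [Fintype m] [Fintype n]
    {F : Submodule ℂ (Matrix m n ℂ)} (hF : F ≠ ⊤) : ∀ᵐ x : m → n → ℂ, Matrix.of x ∉ F := by
  let F' : Submodule ℝ (m → n → ℂ) :=
    (F.comap (Matrix.ofLinearEquiv ℂ).toLinearMap).restrictScalars ℝ
  have hF' : F' ≠ ⊤ := fun h => hF <| by
    rw [Submodule.restrictScalars_eq_top_iff] at h
    exact Submodule.eq_top_iff'.2 fun x => Submodule.eq_top_iff'.1 h x
  have hrow : (volume : Measure (n → ℂ)).IsAddHaarMeasure := Measure.pi.isAddHaarMeasure _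
  have hmatrix : (volume : Measure (m → n → ℂ)).IsAddHaarMeasure := Measure.pi.isAddHaarMeasure _
  exact measure_eq_zero_iff_ae_notMem.1 (Measure.addHaar_submodule volume F' hF')

section

variable {m n : Type*} [Fintype m] [Fintype n] [DecidableEq m] [DecidableEq n] {M : Matrix m m ℂ}
  {W : Matrix n n ℝ} {l c : ℝ}

theorem SelectsEigenvalue.hasEigenvalue_heatOperator
    (h : SelectsEigenvalue (spectrum ℝ W) (spectrum ℂ M) l c) :
    (heatOperator M W).HasEigenvalue c := by
  obtain ⟨w, hw, rfl⟩ := h.exists_mul_eq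
  exact_mod_cast GraphHeat.hasEigenvalue_heatOperator h.mem hw

theorem SelectsEigenvalue.lt_re_of_hasEigenvalue_heatOperator
    (h : SelectsEigenvalue (spectrum ℝ W) (spectrum ℂ M) l c)
    (hW : ⨆ w : ℝ, Module.End.eigenspace (Matrix.toLin' W) w = ⊤) {κ : ℂ}
    (hκ : (heatOperator M W).HasEigenvalue κ) (hκc : κ ≠ c) : c < κ.re := by
  obtain ⟨w, hw, μ, hμ, rfl⟩ := exists_eq_mul_of_hasEigenvalue_heatOperator hW hκ
  rw [Complex.re_ofReal_mul]
  refine (h.lt_or_eq w hw μ hμ).resolve_right ?_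
  rintro ⟨rfl, -, rfl⟩
  exact hκc (by rw [Complex.ofReal_re, Complex.ofReal_mul])

theorem SelectsEigenvalue.mul_eq_smul_of_heatOperator_eq_smul
    (h : SelectsEigenvalue (spectrum ℝ W) (spectrum ℂ M) l c)
    (hW : ⨆ w : ℝ, Module.End.eigenspace (Matrix.toLin' W) w = ⊤) {u : Matrix m n ℂ}
    (hu : heatOperator M W u = (c : ℂ) • u) : M * u = (l : ℂ) • u := by
  refine GraphHeat.mul_eq_smul_of_heatOperator_eq_smul hW (fun w hw μ hμ hc => ?_) hu
  have hre : w * μ.re = c := by rw [← Complex.re_ofReal_mul, ← hc, Complex.ofReal_re]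
  exact ((h.lt_or_eq w hw μ hμ).resolve_left hre.not_gt).2

theorem SelectsEigenvalue.eventually_ae_exists_tendstoInDirection
    (h : SelectsEigenvalue (spectrum ℝ W) (spectrum ℂ M) l c)
    (hW : ⨆ w : ℝ, Module.End.eigenspace (Matrix.toLin' W) w = ⊤) :
    ∀ᶠ t : ℝ in 𝓝[>] 0, ∀ᵐ x : m → n → ℂ, ∃ u : Matrix m n ℂ, M * u = (l : ℂ) • u ∧
      TendstoInDirection (fun k => ((1 - (t : ℂ) • heatOperator M W) ^ k) (Matrix.of x)) u := by
  filter_upwards [eventually_exists_tendstoInDirection_one_sub_smul_pow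
    h.hasEigenvalue_heatOperator fun κ => h.lt_re_of_hasEigenvalue_heatOperator hW]
    with t ⟨F, hF, hlim⟩
  filter_upwards [ae_of_notMem_submodule hF] with x hx
  obtain ⟨u, hu, hdir⟩ := hlim _ hx
  exact ⟨u, h.mul_eq_smul_of_heatOperator_eq_smul hW hu, hdir⟩

end

section

variable {V : Type*} [Fintype V] [DecidableEq V] {G : Digraph V} {K : ℕ}
  {W : Matrix (Fin K) (Fin K) ℝ}

theorem eulerScheme_heatField (h : ℝ) (x : Matrix V (Fin K) ℂ) (n : ℕ) :
    eulerScheme (heatField G W) h x n = ((1 - (h : ℂ) • heatOperator (snaC G) W) ^ n) x := by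
  induction n with
  | zero => rfl
  | succ n ih =>
    rw [pow_succ', Module.End.mul_apply, ← ih, eulerScheme, heatField, smul_neg, ← sub_eq_add_neg]
    rfl

theorem HasPosDegrees.eventually_ae_isFrequencyDominant (hG : HasPosDegrees G)
    (hW : ⨆ w : ℝ, Module.End.eigenspace (Matrix.toLin' W) w = ⊤) {l c : ℝ}
    (h : SelectsEigenvalue (spectrum ℝ W) (spectrum ℂ (snaC G)) l c) :
    ∀ᶠ t : ℝ in 𝓝[>] 0, ∀ᵐ x₀ : V → Fin K → ℂ,
      IsFrequencyDominant G (eulerScheme (heatField G W) t (Matrix.of x₀)) (1 - l) := by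
  filter_upwards [h.eventually_ae_exists_tendstoInDirection hW] with t ht
  filter_upwards [ht] with x₀ ⟨u, hu, hlim⟩
  simp only [← eulerScheme_heatField] at hlim
  exact hG.isFrequencyDominant hu hlim

end

section

variable {S : Set ℝ} {T : Set ℂ} {w₁ wK a ρ : ℝ}

theorem selectsEigenvalue_lowest (hw₁ : IsLeast S w₁) (hwK : IsGreatest S wK)
    (hT : ∀ μ ∈ T, μ.re ∈ Set.Icc a ρ) (haT : (a : ℂ) ∈ T) (ha : ∀ μ ∈ T, μ.re = a → μ = a)
    (hρ : 0 ≤ ρ) (hlt : wK * a < w₁ * ρ) : SelectsEigenvalue S T a (min (w₁ * a) (wK * a)) where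
  mem := haT
  exists_mul_eq := (min_choice (w₁ * a) (wK * a)).elim (fun h => ⟨w₁, hw₁.1, h.symm⟩)
    fun h => ⟨wK, hwK.1, h.symm⟩
  lt_or_eq w hw μ hμ := by
    obtain ⟨haμ, hμρ⟩ := hT μ hμ
    have hw₁w : w₁ ≤ w := hw₁.2 hw
    have hwwK : w ≤ wK := hwK.2 hw
    rcases le_or_gt w 0 with hw₀ | hw₀
    · left
      calc min (w₁ * a) (wK * a) ≤ wK * a := min_le_right _ _
        _ < w₁ * ρ := hlt
        _ ≤ w * ρ := mul_le_mul_of_nonneg_right hw₁w hρ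
        _ ≤ w * μ.re := mul_le_mul_of_nonpos_left hμρ hw₀
    · have hmin : min (w₁ * a) (wK * a) ≤ w * a := by
        rcases le_total 0 a with ha₀ | ha₀
        · exact min_le_of_left_le (mul_le_mul_of_nonneg_right hw₁w ha₀)
        · exact min_le_of_right_le (mul_le_mul_of_nonpos_right hwwK ha₀)
      rcases haμ.eq_or_lt with h | h
      · rcases hmin.lt_or_eq with hlt' | heq
        · exact Or.inl (h ▸ hlt')
        · exact Or.inr ⟨h ▸ heq.symm, hw₀.ne', ha μ hμ h.symm⟩
      · exact Or.inl (hmin.trans_lt (mul_lt_mul_of_pos_left h hw₀))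

theorem selectsEigenvalue_highest (hw₁ : IsLeast S w₁) (hwK : IsGreatest S wK)
    (hT : ∀ μ ∈ T, μ.re ∈ Set.Icc a ρ) (hρT : (ρ : ℂ) ∈ T) (hρ : ∀ μ ∈ T, μ.re = ρ → μ = ρ)
    (hρ₀ : 0 ≤ ρ) (hneg : w₁ * ρ < 0) (hlt : w₁ * ρ < wK * a) :
    SelectsEigenvalue S T ρ (w₁ * ρ) where
  mem := hρT
  exists_mul_eq := ⟨w₁, hw₁.1, rfl⟩
  lt_or_eq w hw μ hμ := by
    obtain ⟨haμ, hμρ⟩ := hT μ hμ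
    have hw₁w : w₁ ≤ w := hw₁.2 hw
    have hwwK : w ≤ wK := hwK.2 hw
    rcases lt_or_ge w 0 with hw₀ | hw₀
    · have hle : w₁ * ρ ≤ w * ρ := mul_le_mul_of_nonneg_right hw₁w hρ₀
      rcases hμρ.eq_or_lt with h | h
      · rcases hle.lt_or_eq with hlt' | heq
        · exact Or.inl (h ▸ hlt')
        · exact Or.inr ⟨h ▸ heq.symm, hw₀.ne, hρ μ hμ h⟩
      · exact Or.inl (hle.trans_lt (mul_lt_mul_of_neg_left h hw₀))
    · left
      have hwa : w₁ * ρ < w * a := by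
        rcases le_total 0 a with ha₀ | ha₀
        · exact hneg.trans_le (mul_nonneg hw₀ ha₀)
        · exact hlt.trans_le (mul_le_mul_of_nonpos_right hwwK ha₀)
      exact hwa.trans_le (mul_le_mul_of_nonneg_left haμ hw₀)

end

end FrequencySelection

section Dominance

variable {V : Type*} [Fintype V] [DecidableEq V] {G : Digraph V} {K : ℕ}
  {W : Matrix (Fin K) (Fin K) ℝ} {w₁ wK : ℝ} {l₁ lN : ℂ}

theorem exists_adj_of_mem_spectrum_snaC {μ : ℂ} (hμ : μ ∈ spectrum ℂ (snaC G)) (hμ₀ : μ ≠ 0) :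
    ∃ u v, G.Adj u v := by
  by_contra! h
  obtain ⟨v, hv₀, hv⟩ := mem_spectrum_iff_exists_mulVec.1 hμ
  rw [snaC_eq_zero_of_forall_not_adj h, Matrix.zero_mulVec, eq_comm, smul_eq_zero] at hv
  exact hv.elim hμ₀ hv₀

theorem IsLowestEigenvalue.re_nonpos_of_forall_not_adj_self
    (hl₁ : IsLowestEigenvalue (snaC G) l₁) (h : ∀ v, ¬G.Adj v v) : l₁.re ≤ 0 := by
  obtain ⟨v, hv₀, -⟩ := mem_spectrum_iff_exists_mulVec.1 hl₁.1
  have hcard : 0 < Fintype.card V := Fintype.card_pos_iff.2 (Function.ne_iff.1 hv₀).nonempty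
  have hle := hl₁.card_mul_re_le_trace_re
  rw [trace_snaC_of_forall_not_adj_self h, Complex.zero_re] at hle
  exact nonpos_of_mul_nonpos_right hle (Nat.cast_pos.2 hcard)

theorem HasPosDegrees.eventually_ae_isHFD (hG : HasPosDegrees G)
    (hW : ⨆ w : ℝ, Module.End.eigenspace (Matrix.toLin' W) w = ⊤)
    (hw₁ : IsLeast (spectrum ℝ W) w₁) (hwK : IsGreatest (spectrum ℝ W) wK)
    (hl₁ : IsLowestEigenvalue (snaC G) l₁) (hlN : IsHighestEigenvalue (snaC G) lN)
    (huniq : ∀ μ ∈ spectrum ℂ (snaC G), μ.re = l₁.re → μ = l₁)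
    (hlt : wK * l₁.re < w₁ * lN.re) :
    ∀ᶠ h : ℝ in 𝓝[>] 0, ∀ᵐ x₀ : V → Fin K → ℂ,
      IsHFD G (eulerScheme (heatField G W) h (Matrix.of x₀)) := by
  have hreal : l₁ = l₁.re := hl₁.eq_ofReal_re huniq
  have hselect := selectsEigenvalue_lowest hw₁ hwK (fun _ => hl₁.re_mem_Icc hlN) (hreal ▸ hl₁.1)
    (hreal ▸ huniq) (hlN.re_nonneg sna_nonneg) hlt
  filter_upwards [hG.eventually_ae_isFrequencyDominant hW hselect] with h hh
  filter_upwards [hh] with x₀ hx₀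
  have hone : ((1 - l₁.re : ℝ) : ℂ) = 1 - l₁ := by
    rw [Complex.ofReal_sub, Complex.ofReal_one, ← hreal]
  exact ⟨1 - l₁.re, hone ▸ hl₁.one_sub, hx₀⟩

theorem mul_re_neg_of_mul_re_lt (hw₁ : IsLeast (spectrum ℝ W) w₁)
    (hwK : IsGreatest (spectrum ℝ W) wK) (hl₁ : IsLowestEigenvalue (snaC G) l₁)
    (hlN : IsHighestEigenvalue (snaC G) lN) (hlt : w₁ * lN.re < wK * l₁.re)
    (hloop : (∃ v, G.Adj v v) → w₁ < 0) : w₁ * lN.re < 0 := by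
  by_contra! hnonneg
  have hpos : 0 < wK * l₁.re := hnonneg.trans_lt hlt
  have hw₁_nonneg : 0 ≤ w₁ := by
    refine nonneg_of_mul_nonneg_left hnonneg ((hlN.re_nonneg sna_nonneg).lt_of_ne' fun h₀ => ?_)
    have hl₁₀ : l₁.re = 0 := by
      have hnorm := hlN.norm_le_re sna_nonneg hl₁.1
      rw [h₀, norm_le_zero_iff] at hnorm
      rw [hnorm, Complex.zero_re]
    exact hpos.ne' (by rw [hl₁₀, mul_zero])
  have hl₁_nonpos : l₁.re ≤ 0 := hl₁.re_nonpos_of_forall_not_adj_self fun v hv =>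
    (hloop ⟨v, hv⟩).not_ge hw₁_nonneg
  exact hpos.not_ge (mul_nonpos_of_nonneg_of_nonpos (hw₁_nonneg.trans (hw₁.2 hwK.1)) hl₁_nonpos)

theorem HasPosDegrees.eventually_ae_isLFD (hG : HasPosDegrees G)
    (hW : ⨆ w : ℝ, Module.End.eigenspace (Matrix.toLin' W) w = ⊤)
    (hw₁ : IsLeast (spectrum ℝ W) w₁) (hwK : IsGreatest (spectrum ℝ W) wK)
    (hl₁ : IsLowestEigenvalue (snaC G) l₁) (hlN : IsHighestEigenvalue (snaC G) lN)
    (hlt : w₁ * lN.re < wK * l₁.re) (hloop : (∃ v, G.Adj v v) → w₁ < 0) :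
    ∀ᶠ h : ℝ in 𝓝[>] 0, ∀ᵐ x₀ : V → Fin K → ℂ,
      IsLFD G (eulerScheme (heatField G W) h (Matrix.of x₀)) := by
  have huniq : ∀ μ ∈ spectrum ℂ (snaC G), μ.re = lN.re → μ = lN.re := fun _ hμ hre =>
    hlN.eq_ofReal_re_of_re_eq sna_nonneg hμ hre
  have hreal : lN = lN.re := huniq lN hlN.1 rfl
  have hselect := selectsEigenvalue_highest hw₁ hwK (fun _ => hl₁.re_mem_Icc hlN) (hreal ▸ hlN.1)
    huniq (hlN.re_nonneg sna_nonneg) (mul_re_neg_of_mul_re_lt hw₁ hwK hl₁ hlN hlt hloop) hlt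
  filter_upwards [hG.eventually_ae_isFrequencyDominant hW hselect] with h hh
  filter_upwards [hh] with x₀ hx₀
  have hone : ((1 - lN.re : ℝ) : ℂ) = 1 - lN := by
    rw [Complex.ofReal_sub, Complex.ofReal_one, ← hreal]
  exact ⟨1 - lN.re, hone ▸ hlN.one_sub, hx₀⟩

theorem exists_adj_of_mul_re_ne (hl₁ : l₁ ∈ spectrum ℂ (snaC G)) (hlN : lN ∈ spectrum ℂ (snaC G))
    (hne : wK * l₁.re ≠ w₁ * lN.re) : ∃ u v, G.Adj u v := by
  by_cases h₁ : l₁ = 0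
  · refine exists_adj_of_mem_spectrum_snaC hlN fun hN => hne ?_
    rw [h₁, hN, Complex.zero_re, mul_zero, mul_zero]
  · exact exists_adj_of_mem_spectrum_snaC hl₁ h₁

end Dominance

end GraphHeat

end

theorem mainTheorem8_general {V : Type*} [Fintype V] [DecidableEq V] {K : ℕ}
    (G : Digraph V) (hG : (∃ u v, G.Adj u v) → GraphHeat.HasPosDegrees G)
    (W : Matrix (Fin K) (Fin K) ℝ)
    (hW : ⨆ w : ℝ, Module.End.eigenspace (Matrix.toLin' W) w = ⊤)
    (w₁ wK : ℝ) (hw₁ : IsLeast (spectrum ℝ W) w₁) (hwK : IsGreatest (spectrum ℝ W) wK)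
    (l₁ lN : ℂ) (hl₁ : GraphHeat.IsLowestEigenvalue (GraphHeat.snaC G) l₁)
    (hlN : GraphHeat.IsHighestEigenvalue (GraphHeat.snaC G) lN) :
    ∃ h₀ : ℝ, 0 < h₀ ∧ ∀ h : ℝ, 0 < h → h < h₀ →
      ∀ᵐ x₀ : V → Fin K → ℂ,
        (((∀ m ∈ spectrum ℂ (GraphHeat.snaC G), m.re = l₁.re → m = l₁) →
            wK * l₁.re < w₁ * lN.re →
            GraphHeat.IsHFD G
              (GraphHeat.eulerScheme (GraphHeat.heatField G W) h (Matrix.of x₀))) ∧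
          (w₁ * lN.re < wK * l₁.re →
            ((∃ v, G.Adj v v) → w₁ < 0) →
            GraphHeat.IsLFD G
              (GraphHeat.eulerScheme (GraphHeat.heatField G W) h (Matrix.of x₀)))) := by
  have hHFD : ∀ᶠ h : ℝ in 𝓝[>] 0, ∀ᵐ x₀ : V → Fin K → ℂ,
      (∀ m ∈ spectrum ℂ (GraphHeat.snaC G), m.re = l₁.re → m = l₁) → wK * l₁.re < w₁ * lN.re →
        GraphHeat.IsHFD G (GraphHeat.eulerScheme (GraphHeat.heatField G W) h (Matrix.of x₀)) := by
    simp only [eventually_imp_distrib_left]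
    intro huniq hlt
    exact (hG (GraphHeat.exists_adj_of_mul_re_ne hl₁.1 hlN.1 hlt.ne)).eventually_ae_isHFD
      hW hw₁ hwK hl₁ hlN huniq hlt
  have hLFD : ∀ᶠ h : ℝ in 𝓝[>] 0, ∀ᵐ x₀ : V → Fin K → ℂ,
      w₁ * lN.re < wK * l₁.re → ((∃ v, G.Adj v v) → w₁ < 0) →
        GraphHeat.IsLFD G (GraphHeat.eulerScheme (GraphHeat.heatField G W) h (Matrix.of x₀)) := by
    simp only [eventually_imp_distrib_left]
    intro hlt hloop
    exact (hG (GraphHeat.exists_adj_of_mul_re_ne hl₁.1 hlN.1 hlt.ne')).eventually_ae_isLFD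
      hW hw₁ hwK hl₁ hlN hlt hloop
  obtain ⟨h₀, hh₀, hsub⟩ := mem_nhdsGT_iff_exists_Ioo_subset.1 (hHFD.and hLFD)
  exact ⟨h₀, hh₀, fun h hpos hlt => (hsub ⟨hpos, hlt⟩).1.and (hsub ⟨hpos, hlt⟩).2⟩

theorem mainTheorem8 {V : Type*} [Fintype V] [DecidableEq V] {K : ℕ}
    (G : Digraph V) (hG : GraphHeat.StronglyConnected G)
    (W : Matrix (Fin K) (Fin K) ℝ) (hW : W.IsDiag)
    (w₁ wK : ℝ) (hw₁ : IsLeast (spectrum ℝ W) w₁) (hwK : IsGreatest (spectrum ℝ W) wK)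
    (l₁ lN : ℂ) (hl₁ : GraphHeat.IsLowestEigenvalue (GraphHeat.snaC G) l₁)
    (hlN : GraphHeat.IsHighestEigenvalue (GraphHeat.snaC G) lN) :
    ∃ h₀ : ℝ, 0 < h₀ ∧ ∀ h : ℝ, 0 < h → h < h₀ →
      ∀ᵐ x₀ : V → Fin K → ℂ,
        (((∀ m ∈ spectrum ℂ (GraphHeat.snaC G), m.re = l₁.re → m = l₁) →
            wK * l₁.re < w₁ * lN.re →
            GraphHeat.IsHFD G
              (GraphHeat.eulerScheme (GraphHeat.heatField G W) h (Matrix.of x₀))) ∧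
          (w₁ * lN.re < wK * l₁.re →
            ((∃ v, G.Adj v v) → w₁ < 0) →
            GraphHeat.IsLFD G
              (GraphHeat.eulerScheme (GraphHeat.heatField G W) h (Matrix.of x₀)))) :=
  mainTheorem8_general G hG.hasPosDegrees W
    (hW.diagonal_diag ▸ Matrix.iSup_eigenspace_toLin'_diagonal_eq_top _)
    w₁ wK hw₁ hwK l₁ lN hl₁ hlN
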